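/- There is a universal constant $c>0$ such that the following holds. Let $d\ge 2$ be an integer and let $L,B,\epsilon>0$. Then there is $N=N(d,L,B,\epsilon)$ such that for every $n\ge N$, every feature map $\phi:\mathcal S\times\mathcal A\to\mathbb R^d$ with $\|\phi(s,a)\|\le L$ for all $(s,a)$, and every fixed design $(s_i,a_i^0,a_i^1)_{i=1}^n$ in $\mathcal S\times\mathcal A\times\mathcal A$, the following is true. For $\theta\in\mathbb R^d$ let the labels $y_1,\dots,y_n\in\{0,1\}$ be independent and follow the Bradley–Terry–Luce model with linear reward, $$\mathbb P_\theta[y_i=l]=\frac{\exp(\phi(s_i,a_i^l)^\top\theta)}{\exp(\phi(s_i,a_i^0)^\top\theta)+\exp(\phi(s_i,a_i^1)^\top\theta)},\qquad l\in\{0,1\}.$$ Each label is privatized independently by an $\epsilon$-label-DP local randomizer $\mathcal R_i$ (with values in an arbitrary measurable space), i.e. $\mathbb P[\mathcal R_i(y)\in E]\le e^{\epsilon}\,\mathbb P[\mathcal R_i(y')\in E]$ for all $y,y'\in\{0,1\}$ and all measurable $E$. Let $\hat\theta$ be any (possibly randomized) estimator with values in $\mathbb R^d$ that is computed from the privatized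 labels $\mathcal R_1(y_1),\dots,\mathcal R_n(y_n)$ (the design, $\phi$ and the randomizers being known). Then there is a parameter $\theta^*\in\Theta_B=\{\theta\in\mathbb R^d:\langle\mathbf 1,\theta\rangle=0,\ \|\theta\|\le B\}$ such that, when the labels are generated with $\theta=\theta^*$, $$\mathbb E\,\|\hat\theta-\theta^*\|^2\;\ge\; c\,\frac{d}{L^2}\left(\frac dn+\frac{d}{(e^{\epsilon}-1)^2\,n}\right),$$ where $\|\cdot\|$ is the Euclidean norm and the expectation is over the labels, the randomizers and the estimator. In particular, the worst-case risk over $\Theta_B$ of every locally $\epsilon$-label-DP estimator is $\Omega\!\left(\frac{d}{L^2}\left(\frac dn+\frac{d}{(e^\epsilon-1)^2n}\right)\right)$. -/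

import Mathlib

open MeasureTheory ProbabilityTheory
open scoped ENNReal

namespace LabelDP

/-- The parameter set `Θ_B = {θ ∈ ℝᵈ : ⟨𝟏, θ⟩ = 0, ‖θ‖₂ ≤ B}`. -/
def paramSet (d : ℕ) (B : ℝ) : Set (EuclideanSpace ℝ (Fin d)) :=
  {θ | ∑ j, θ j = 0 ∧ ‖θ‖ ≤ B}

/-- The linear reward `r_θ(s, a) = φ(s, a)ᵀ θ`. -/
noncomputable def reward {S A : Type*} {d : ℕ} (φ : S → A → EuclideanSpace ℝ (Fin d))
    (θ : EuclideanSpace ℝ (Fin d)) (s : S) (a : A) : ℝ :=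
  inner ℝ (φ s a) θ

/-- The Bradley-Terry-Luce probability that the label is `l ∈ {0, 1}`, at the state `s` and for
the pair of actions `(a 0, a 1)`. -/
noncomputable def btlProb {S A : Type*} {d : ℕ} (φ : S → A → EuclideanSpace ℝ (Fin d))
    (θ : EuclideanSpace ℝ (Fin d)) (s : S) (a : Fin 2 → A) (l : Fin 2) : ℝ :=
  Real.exp (reward φ θ s (a l)) /
    (Real.exp (reward φ θ s (a 0)) + Real.exp (reward φ θ s (a 1)))

/-- The Bradley-Terry-Luce law of a label, as a measure on `{0, 1}`. -/
noncomputable def labelLaw {S A : Type*} {d : ℕ} (φ : S → A → EuclideanSpace ℝ (Fin d))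
    (θ : EuclideanSpace ℝ (Fin d)) (s : S) (a : Fin 2 → A) : Measure (Fin 2) :=
  ∑ l, ENNReal.ofReal (btlProb φ θ s a l) • Measure.dirac l

/-- The label law is a probability measure. -/
instance isProbabilityMeasure_labelLaw {S A : Type*} {d : ℕ}
    (φ : S → A → EuclideanSpace ℝ (Fin d)) (θ : EuclideanSpace ℝ (Fin d)) (s : S)
    (a : Fin 2 → A) : IsProbabilityMeasure (labelLaw φ θ s a) := by
  constructor
  have h0 : 0 ≤ btlProb φ θ s a 0 := by unfold btlProb; positivity
  have h1 : 0 ≤ btlProb φ θ s a 1 := by unfold btlProb; positivity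
  have hs : btlProb φ θ s a 0 + btlProb φ θ s a 1 = 1 := by
    unfold btlProb
    rw [← add_div]
    exact div_self (by positivity)
  simp only [labelLaw, Fin.sum_univ_two, Measure.coe_add, Measure.coe_smul, Pi.add_apply,
    Pi.smul_apply, measure_univ, smul_eq_mul, mul_one]
  rw [← ENNReal.ofReal_add h0 h1, hs, ENNReal.ofReal_one]

/-- The randomizer `R`, a Markov kernel from labels to an output space `Z`, is an
`(ε, δ)`-label differentially private local randomizer. -/
def IsLabelDPRandomizer {Z : Type*} [MeasurableSpace Z] (ε δ : ℝ) (R : Kernel (Fin 2) Z) : Prop :=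
  ∀ (y y' : Fin 2) (E : Set Z), MeasurableSet E →
    R y E ≤ ENNReal.ofReal (Real.exp ε) * R y' E + ENNReal.ofReal δ

/-- The joint law of the privatized labels `(R₁(y₁), …, Rₙ(yₙ))`, where the labels `yᵢ` are
independent and follow the Bradley-Terry-Luce model with parameter `θ` at the queries
`(sᵢ, aᵢ⁰, aᵢ¹)`, and each labeler applies her own randomizer `Rᵢ` independently. -/
noncomputable def privateLaw {S A : Type*} {d n : ℕ} (φ : S → A → EuclideanSpace ℝ (Fin d))
    (θ : EuclideanSpace ℝ (Fin d)) (s : Fin n → S) (a : Fin n → Fin 2 → A)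
    {Z : Fin n → Type*} [∀ i, MeasurableSpace (Z i)] (R : ∀ i, Kernel (Fin 2) (Z i)) :
    Measure (∀ i, Z i) :=
  Measure.pi fun i => (labelLaw φ θ (s i) (a i)).bind (R i)

/-- The expected squared `ℓ₂` error `𝔼 ‖θ̂ - θ‖²`, in `[0, ∞]`, of the (possibly randomized)
estimator `est`, which maps the privatized labels to a random element of `ℝᵈ`. -/
noncomputable def l2Risk {S A : Type*} {d n : ℕ} (φ : S → A → EuclideanSpace ℝ (Fin d))
    (θ : EuclideanSpace ℝ (Fin d)) (s : Fin n → S) (a : Fin n → Fin 2 → A)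
    {Z : Fin n → Type*} [∀ i, MeasurableSpace (Z i)] (R : ∀ i, Kernel (Fin 2) (Z i))
    (est : Kernel (∀ i, Z i) (EuclideanSpace ℝ (Fin d))) : ℝ≥0∞ :=
  ∫⁻ z, ∫⁻ t, ‖t - θ‖ₑ ^ 2 ∂(est z) ∂(privateLaw φ θ s a R)

end LabelDP

/-! The bound is Assouad's method on a hypercube of parameters `δ ∑ ±(e_j - e_{k+j})` with `k = d /
2`, which lies in the sum-zero hyperplane.

Privacy enters through one number: an `ε`-DP randomizer has output densities `(1 ∓ h) / 2` with `|h|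
≤ τ = (e^ε - 1) / (e^ε + 1)` (`IsLabelDPRandomizer.exists_density`). A label of bias `b` then has
privatized density `(1 + b h) / 2` (`labelLaw_bind_eq`), so changing the bias by `Δ` costs at most
`Δ² τ² / 4` in Hellinger affinity (`one_sub_le_affinity`). These costs add over samples
(`integral_min_prod_ge`). By a Bessel-type bound (`sum_inner_pairVec_sq_le`), all `k` bit flips
together cost `O(δ² τ² L²)` per sample, without a factor `k`.

With `δ² ≍ k / (τ² L² n)` an average bit flip leaves constant overlap, and `exists_risk_ge` gives
risk of order `k δ² ≍ d² / (τ² L² n)`. Finally `1 / τ² ≥ 1 + 1 / (e^ε - 1)²` yields both terms. -/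

namespace LabelDP

/-! ### Densities of private outputs and overlap of product laws. -/

/-- A product of measures with bounded densities has the product density. -/
theorem pi_withDensity_ofReal {ι : Type*} [Fintype ι] {Z : ι → Type*}
    [∀ i, MeasurableSpace (Z i)] (ν : ∀ i, Measure (Z i)) [∀ i, IsFiniteMeasure (ν i)]
    (F : ∀ i, Z i → ℝ) (hm : ∀ i, Measurable (F i)) (h0 : ∀ i z, 0 ≤ F i z)
    (h1 : ∀ i z, F i z ≤ 1) :
    Measure.pi (fun i => (ν i).withDensity fun z => ENNReal.ofReal (F i z)) =
      (Measure.pi ν).withDensity fun z => ENNReal.ofReal (∏ i, F i (z i)) := by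
  have hfin : ∀ i, IsFiniteMeasure ((ν i).withDensity fun z => ENNReal.ofReal (F i z)) := by
    intro i
    refine isFiniteMeasure_withDensity ?_
    refine ((lintegral_mono fun z => ENNReal.ofReal_le_ofReal (h1 i z)).trans_lt ?_).ne
    simp
  symm
  refine (Measure.pi_eq fun s hs => ?_).symm
  have hG : ∀ i, Measurable ((s i).indicator (F i)) := fun i => (hm i).indicator (hs i)
  have hG0 : ∀ i z, 0 ≤ (s i).indicator (F i) z := fun i z =>
    Set.indicator_nonneg (fun z _ => h0 i z) z
  have hG1 : ∀ i z, (s i).indicator (F i) z ≤ 1 := fun i z =>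
    (Set.indicator_le_self' (fun z _ => h0 i z) z).trans (h1 i z)
  have hind : ∀ z : ∀ i, Z i, (Set.univ.pi s).indicator
      (fun z => ENNReal.ofReal (∏ i, F i (z i))) z =
        ENNReal.ofReal (∏ i, (s i).indicator (F i) (z i)) := by
    intro z
    by_cases hz : z ∈ Set.univ.pi s
    · rw [Set.indicator_of_mem hz]
      congr 1
      exact Finset.prod_congr rfl fun i _ => (Set.indicator_of_mem (hz i trivial) _).symm
    · rw [Set.indicator_of_notMem hz]
      simp only [Set.mem_pi, Set.mem_univ, true_implies, not_forall] at hz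
      obtain ⟨i, hi⟩ := hz
      rw [Finset.prod_eq_zero (Finset.mem_univ i) (Set.indicator_of_notMem hi _),
        ENNReal.ofReal_zero]
  have hmp : Measurable fun z : ∀ i, Z i => ∏ i, (s i).indicator (F i) (z i) :=
    Finset.measurable_prod _ fun i _ => (hG i).comp (measurable_pi_apply i)
  rw [withDensity_apply _ (MeasurableSet.univ_pi hs),
    ← lintegral_indicator (MeasurableSet.univ_pi hs), lintegral_congr hind,
    ← ofReal_integral_eq_lintegral_ofReal, integral_fintype_prod_eq_prod,
    ENNReal.ofReal_prod_of_nonneg fun i _ => integral_nonneg (hG0 i)]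
  · refine Finset.prod_congr rfl fun i _ => ?_
    rw [withDensity_apply _ (hs i), ← lintegral_indicator (hs i),
      ofReal_integral_eq_lintegral_ofReal]
    · refine lintegral_congr fun z => ?_
      by_cases hz : z ∈ s i <;> simp [hz]
    · exact Integrable.of_bound (hG i).aestronglyMeasurable 1
        (ae_of_all _ fun z => by rw [Real.norm_of_nonneg (hG0 i z)]; exact hG1 i z)
    · exact ae_of_all _ (hG0 i)
  · refine Integrable.of_bound hmp.aestronglyMeasurable 1 (ae_of_all _ fun z => ?_)
    rw [Real.norm_of_nonneg (Finset.prod_nonneg fun i _ => hG0 i _)]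
    exact Finset.prod_le_one (fun i _ => hG0 i _) fun i _ => hG1 i _
  · exact ae_of_all _ fun z => Finset.prod_nonneg fun i _ => hG0 i _

/-- The two output laws of an `ε`-DP randomizer have densities `(1 ∓ h) / 2` with respect to their
sum, with `|h| ≤ tanh (ε / 2)`. -/
theorem IsLabelDPRandomizer.exists_density {Z : Type*} [MeasurableSpace Z] {ε : ℝ} (hε : 0 < ε)
    {R : Kernel (Fin 2) Z} [IsMarkovKernel R] (hR : IsLabelDPRandomizer ε 0 R) :
    ∃ h : Z → ℝ, Measurable h ∧ (∀ z, |h z| ≤ (Real.exp ε - 1) / (Real.exp ε + 1)) ∧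
      R 0 = (R 0 + R 1).withDensity (fun z => ENNReal.ofReal ((1 - h z) / 2)) ∧
      R 1 = (R 0 + R 1).withDensity (fun z => ENNReal.ofReal ((1 + h z) / 2)) := by
  set ν := R 0 + R 1 with hν
  set E := Real.exp ε
  have hE : 1 < E := Real.one_lt_exp_iff.2 hε
  set τ := (E - 1) / (E + 1) with hτ
  have hτ0 : 0 ≤ τ := div_nonneg (by linarith) (by linarith)
  have hle : ∀ y, R y ≤ ν := by
    intro y
    fin_cases y
    · exact Measure.le_add_right le_rfl
    · exact Measure.le_add_left le_rfl
  set f : Fin 2 → Z → ℝ≥0∞ := fun y => (R y).rnDeriv ν with hf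
  have hfm : ∀ y, Measurable (f y) := fun y => Measure.measurable_rnDeriv _ _
  have hfR : ∀ y, ν.withDensity (f y) = R y := fun y =>
    Measure.withDensity_rnDeriv_eq _ _ (hle y).absolutelyContinuous
  have hsum : ∀ᵐ z ∂ν, f 0 z + f 1 z = 1 := by
    filter_upwards [Measure.rnDeriv_add (R 0) (R 1) ν, Measure.rnDeriv_self ν] with z h1 h2
    rw [← hν, h2] at h1
    exact h1.symm
  have hcomp : ∀ y y', ∀ᵐ z ∂ν, f y z ≤ ENNReal.ofReal E * f y' z := by
    intro y y'
    refine ae_le_of_forall_setLIntegral_le_of_sigmaFinite (hfm y) fun s hs _ => ?_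
    rw [lintegral_const_mul _ (hfm y'), ← withDensity_apply _ hs, ← withDensity_apply _ hs,
      hfR, hfR]
    simpa using hR y y' s hs
  -- The density comparison holds only almost everywhere; clamping to `[-τ, τ]` makes the bound on
  -- `h` hold everywhere.
  set h : Z → ℝ := fun z => max (-τ) (min τ ((f 1 z).toReal - (f 0 z).toReal)) with hh
  have hreal : ∀ᵐ z ∂ν, f 0 z = ENNReal.ofReal ((1 - h z) / 2) ∧
      f 1 z = ENNReal.ofReal ((1 + h z) / 2) := by
    filter_upwards [hsum, hcomp 0 1, hcomp 1 0] with z hs h01 h10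
    have t0 : f 0 z ≠ ∞ := fun ht => by simp [ht] at hs
    have t1 : f 1 z ≠ ∞ := fun ht => by simp [ht] at hs
    have hs' : (f 0 z).toReal + (f 1 z).toReal = 1 := by
      rw [← ENNReal.toReal_add t0 t1, hs, ENNReal.toReal_one]
    have h01' := ENNReal.toReal_mono (ENNReal.mul_ne_top ENNReal.ofReal_ne_top t1) h01
    have h10' := ENNReal.toReal_mono (ENNReal.mul_ne_top ENNReal.ofReal_ne_top t0) h10
    rw [ENNReal.toReal_mul, ENNReal.toReal_ofReal (by linarith)] at h01' h10'
    have hz : h z = (f 1 z).toReal - (f 0 z).toReal := by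
      have a1 : (f 1 z).toReal - (f 0 z).toReal ≤ τ := by
        rw [hτ, le_div_iff₀ (by linarith)]; nlinarith
      have a2 : -τ ≤ (f 1 z).toReal - (f 0 z).toReal := by
        rw [hτ, ← neg_div, div_le_iff₀ (by linarith)]; nlinarith
      simp only [hh]
      rw [min_eq_right a1, max_eq_right a2]
    constructor
    · rw [hz, show (1 - ((f 1 z).toReal - (f 0 z).toReal)) / 2 = (f 0 z).toReal by linarith,
        ENNReal.ofReal_toReal t0]
    · rw [hz, show (1 + ((f 1 z).toReal - (f 0 z).toReal)) / 2 = (f 1 z).toReal by linarith,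
        ENNReal.ofReal_toReal t1]
  refine ⟨h, ?_, fun z => abs_le.2 ⟨le_max_left _ _, max_le (by linarith) (min_le_left _ _)⟩, ?_, ?_⟩
  · exact measurable_const.max
      (measurable_const.min ((hfm 1).ennreal_toReal.sub (hfm 0).ennreal_toReal))
  · rw [← hfR 0]
    exact withDensity_congr_ae (hreal.mono fun z hz => hz.1)
  · rw [← hfR 1]
    exact withDensity_congr_ae (hreal.mono fun z hz => hz.2)

/-- Two product densities whose factors have Hellinger affinity at least `1 - x i` overlap. -/
theorem integral_min_prod_ge {ι : Type*} [Fintype ι] {Z : ι → Type*}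
    [∀ i, MeasurableSpace (Z i)] (ν : ∀ i, Measure (Z i)) [∀ i, IsFiniteMeasure (ν i)]
    (F G : ∀ i, Z i → ℝ) (hFm : ∀ i, Measurable (F i)) (hGm : ∀ i, Measurable (G i))
    (hF0 : ∀ i z, 0 ≤ F i z) (hG0 : ∀ i z, 0 ≤ G i z)
    (hF1 : ∀ i z, F i z ≤ 1) (hG1 : ∀ i z, G i z ≤ 1)
    (hF : ∀ i, ∫ z, F i z ∂ν i = 1) (hG : ∀ i, ∫ z, G i z ∂ν i = 1)
    (x : ι → ℝ) (hx0 : ∀ i, 0 ≤ x i) (hx1 : ∀ i, x i ≤ 1)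
    (hx : ∀ i, 1 - x i ≤ ∫ z, √(F i z * G i z) ∂ν i) :
    4 / 3 * (1 / 2 - ∑ i, x i) ≤
      ∫ z, min (∏ i, F i (z i)) (∏ i, G i (z i)) ∂Measure.pi ν := by
  have hint : ∀ H : (∀ i, Z i) → ℝ, Measurable H → (∀ z, 0 ≤ H z) → (∀ z, H z ≤ 1) →
      Integrable H (Measure.pi ν) := fun H hm h0 h1 =>
    Integrable.of_bound hm.aestronglyMeasurable 1
      (ae_of_all _ fun z => by rw [Real.norm_of_nonneg (h0 z)]; exact h1 z)
  have hmp : ∀ H : ∀ i, Z i → ℝ, (∀ i, Measurable (H i)) →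
      Measurable fun z : ∀ i, Z i => ∏ i, H i (z i) := fun H hH =>
    Finset.measurable_prod _ fun i _ => (hH i).comp (measurable_pi_apply i)
  have hPF0 : ∀ z : ∀ i, Z i, 0 ≤ ∏ i, F i (z i) := fun z => Finset.prod_nonneg fun i _ => hF0 i _
  have hPG0 : ∀ z : ∀ i, Z i, 0 ≤ ∏ i, G i (z i) := fun z => Finset.prod_nonneg fun i _ => hG0 i _
  have hPF1 : ∀ z : ∀ i, Z i, ∏ i, F i (z i) ≤ 1 := fun z =>
    Finset.prod_le_one (fun i _ => hF0 i _) fun i _ => hF1 i _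
  have hPG1 : ∀ z : ∀ i, Z i, ∏ i, G i (z i) ≤ 1 := fun z =>
    Finset.prod_le_one (fun i _ => hG0 i _) fun i _ => hG1 i _
  have hiF := hint _ (hmp F hFm) hPF0 hPF1
  have hiG := hint _ (hmp G hGm) hPG0 hPG1
  have hsq : ∀ i, Measurable fun z => √(F i z * G i z) := fun i =>
    ((hFm i).mul (hGm i)).sqrt
  have hsq1 : ∀ i z, √(F i z * G i z) ≤ 1 := fun i z => by
    refine Real.sqrt_le_one.2 ?_
    exact mul_le_one₀ (hF1 i z) (hG0 i z) (hG1 i z)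
  have hiS := hint _ (hmp (fun i z => √(F i z * G i z)) hsq)
    (fun z => Finset.prod_nonneg fun i _ => Real.sqrt_nonneg _)
    (fun z => Finset.prod_le_one (fun i _ => Real.sqrt_nonneg _) fun i _ => hsq1 i _)
  have hrho : 1 - ∑ i, x i ≤
      ∫ z : ∀ i, Z i, ∏ i, √(F i (z i) * G i (z i)) ∂Measure.pi ν := by
    rw [integral_fintype_prod_eq_prod (𝕜 := ℝ) (fun i z => √(F i z * G i z))]
    refine le_trans ?_ (Finset.prod_le_prod (fun i _ => sub_nonneg.2 (hx1 i)) fun i _ => hx i)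
    -- Weierstrass product inequality: `∏ (1 - x i) ≥ 1 - ∑ x i`.
    induction (Finset.univ : Finset ι) using Finset.cons_induction with
    | empty => simp
    | cons i s hi ih =>
      rw [Finset.sum_cons, Finset.prod_cons]
      have hp : ∏ j ∈ s, (1 - x j) ≤ 1 :=
        Finset.prod_le_one (fun j _ => sub_nonneg.2 (hx1 j)) fun j _ => by linarith [hx0 j]
      nlinarith [hx0 i, hx1 i]
  -- By AM-GM `√(a b) ≤ a + b / 4`, and symmetrically; hence a bound on the overlap that is linear
  -- in the affinity.
  have hpt : ∀ z : ∀ i, Z i, 4 / 3 * ((∏ i, √(F i (z i) * G i (z i))) -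
      ((∏ i, F i (z i)) + ∏ i, G i (z i)) / 4) ≤ min (∏ i, F i (z i)) (∏ i, G i (z i)) := by
    intro z
    have hS : (∏ i, √(F i (z i) * G i (z i))) ^ 2 = (∏ i, F i (z i)) * ∏ i, G i (z i) := by
      rw [← Finset.prod_pow, ← Finset.prod_mul_distrib]
      exact Finset.prod_congr rfl fun i _ => Real.sq_sqrt (mul_nonneg (hF0 i _) (hG0 i _))
    have hS0 : 0 ≤ ∏ i, √(F i (z i) * G i (z i)) :=
      Finset.prod_nonneg fun i _ => Real.sqrt_nonneg _
    have ha := hPF0 z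
    have hb := hPG0 z
    generalize (∏ i, √(F i (z i) * G i (z i))) = S at *
    generalize (∏ i, F i (z i)) = a at *
    generalize (∏ i, G i (z i)) = b at *
    have h1 : S ≤ a + b / 4 := abs_le_of_sq_le_sq' (by nlinarith [sq_nonneg (a - b / 4)])
      (by linarith) |>.2
    have h2 : S ≤ b + a / 4 := abs_le_of_sq_le_sq' (by nlinarith [sq_nonneg (b - a / 4)])
      (by linarith) |>.2
    exact le_min (by linarith) (by linarith)
  have := integral_mono ((hiS.sub ((hiF.add hiG).div_const 4)).const_mul (4 / 3))
    (hint _ ((hmp F hFm).min (hmp G hGm)) (fun z => le_min (hPF0 z) (hPG0 z))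
      fun z => (min_le_left _ _).trans (hPF1 z)) hpt
  refine le_trans ?_ this
  have hcalc : ∫ z : ∀ i, Z i, 4 / 3 * ((∏ i, √(F i (z i) * G i (z i))) -
      ((∏ i, F i (z i)) + ∏ i, G i (z i)) / 4) ∂Measure.pi ν = 4 / 3 *
        ((∫ z : ∀ i, Z i, ∏ i, √(F i (z i) * G i (z i)) ∂Measure.pi ν) - (1 + 1) / 4) := by
    have hiFG : Integrable (fun z : ∀ i, Z i => ((∏ i, F i (z i)) + ∏ i, G i (z i)) / 4)
        (Measure.pi ν) := (hiF.add hiG).div_const 4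
    rw [integral_const_mul, integral_sub hiS hiFG, integral_div, integral_add hiF hiG, integral_fintype_prod_eq_prod (𝕜 := ℝ) F,
      integral_fintype_prod_eq_prod (𝕜 := ℝ) G]
    simp only [hF, hG, Finset.prod_const_one]
  refine le_trans ?_ hcalc.ge
  linarith

end LabelDP

/-! ### Affinity for one sample and the bias of a label. -/

namespace LabelDP

/-- With `m = (a + b) / 2` and `D = (a - b)²`, one has `a b = m² - D / 4`, and `(m - D / 2)²` is no
larger exactly when `D = 0` or `D / 2 ≤ a + b - 1 / 2`. -/
theorem sqrt_mul_ge {a b : ℝ} (ha : 1 / 4 ≤ a) (hb : 1 / 4 ≤ b) (hab : |a - b| ≤ 1) :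
    (a + b) / 2 - (a - b) ^ 2 / 2 ≤ √(a * b) := by
  refine Real.le_sqrt_of_sq_le ?_
  have h1 : (a - b) ^ 2 / 2 ≤ a + b - 1 / 2 := by
    rcases abs_cases (a - b) with ⟨h, _⟩ | ⟨h, _⟩ <;> rw [h] at hab <;> nlinarith
  nlinarith [sq_nonneg (a - b)]

/-- Hellinger affinity of two densities `(1 + t h) / 2` and `(1 + u h) / 2`. -/
theorem one_sub_le_affinity {Z : Type*} [MeasurableSpace Z] {ν : Measure Z} [IsFiniteMeasure ν]
    (hν : ν.real Set.univ = 2) {h : Z → ℝ} (hm : Measurable h) {τ : ℝ} (hτ : τ ≤ 1)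
    (hb : ∀ z, |h z| ≤ τ) (h0 : ∫ z, h z ∂ν = 0) {t u : ℝ} (ht : |t| ≤ 1 / 2) (hu : |u| ≤ 1 / 2) :
    1 - (t - u) ^ 2 * τ ^ 2 / 4 ≤ ∫ z, √((1 + t * h z) / 2 * ((1 + u * h z) / 2)) ∂ν := by
  have hbd : ∀ v : ℝ, |v| ≤ 1 / 2 → ∀ z, |v * h z| ≤ 1 / 2 := fun v hv z => by
    rw [abs_mul]
    nlinarith [abs_nonneg v, abs_nonneg (h z), hb z]
  have hih : Integrable h ν := Integrable.of_bound hm.aestronglyMeasurable τ (ae_of_all _ hb)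
  -- The biases are at most `1 / 2`, so both densities are at least `1 / 4`. The term linear in `h`
  -- integrates to zero, leaving only a quadratic loss.
  have hpt : ∀ z, (1 / 2 - (t - u) ^ 2 * τ ^ 2 / 8) + (t + u) / 4 * h z ≤
      √((1 + t * h z) / 2 * ((1 + u * h z) / 2)) := by
    intro z
    have h1 := abs_le.1 (hbd t ht z)
    have h2 := abs_le.1 (hbd u hu z)
    refine le_trans ?_ (sqrt_mul_ge (by linarith) (by linarith) (abs_le.2 ⟨by linarith, by linarith⟩))
    have h3 : h z ^ 2 ≤ τ ^ 2 := sq_le_sq' (abs_le.1 (hb z)).1 (abs_le.1 (hb z)).2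
    nlinarith [mul_le_mul_of_nonneg_left h3 (sq_nonneg (t - u))]
  have hsm : Measurable fun z => √((1 + t * h z) / 2 * ((1 + u * h z) / 2)) := by fun_prop
  have hsi : Integrable (fun z => √((1 + t * h z) / 2 * ((1 + u * h z) / 2))) ν := by
    refine Integrable.of_bound hsm.aestronglyMeasurable 1 (ae_of_all _ fun z => ?_)
    have h1 := abs_le.1 (hbd t ht z)
    have h2 := abs_le.1 (hbd u hu z)
    rw [Real.norm_of_nonneg (Real.sqrt_nonneg _)]
    exact Real.sqrt_le_one.2 (mul_le_one₀ (by linarith) (by linarith) (by linarith))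
  have := integral_mono ((integrable_const _).add (hih.const_mul ((t + u) / 4))) hsi hpt
  refine le_trans (le_of_eq ?_) this
  simp only [Pi.add_apply]
  rw [integral_add (integrable_const _) (hih.const_mul _), integral_const_mul, h0, integral_const,
    hν, smul_eq_mul]
  ring

/-- The bias `2 σ(u) - 1` of a Bernoulli law with log-odds `u`. -/
noncomputable def bias (u : ℝ) : ℝ := 2 * Real.sigmoid u - 1

/-- Mean value inequality; the derivative `2 σ (1 - σ)` is even at most `1 / 2`, but `1` suffices.
-/
theorem abs_bias_sub_le (u v : ℝ) : |bias u - bias v| ≤ |u - v| := by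
  have h : ∀ x ∈ (Set.univ : Set ℝ),
      HasDerivWithinAt bias (2 * (Real.sigmoid x * (1 - Real.sigmoid x))) Set.univ x :=
    fun x _ => (((Real.hasDerivAt_sigmoid x).const_mul 2).sub_const 1).hasDerivWithinAt
  have hb : ∀ x ∈ (Set.univ : Set ℝ), ‖2 * (Real.sigmoid x * (1 - Real.sigmoid x))‖ ≤ 1 := by
    intro x _
    have h1 := Real.sigmoid_pos x
    have h2 := Real.sigmoid_lt_one x
    rw [Real.norm_of_nonneg (by nlinarith)]
    nlinarith [sq_nonneg (2 * Real.sigmoid x - 1)]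
  simpa using convex_univ.norm_image_sub_le_of_norm_hasDerivWithin_le h hb (Set.mem_univ v)
    (Set.mem_univ u)

theorem abs_bias_le (u : ℝ) : |bias u| ≤ |u| := by
  have := abs_bias_sub_le u 0
  have h0 : bias 0 = 0 := by rw [bias, Real.sigmoid_zero]; norm_num
  rwa [h0, sub_zero, sub_zero] at this

theorem btlProb_eq {S A : Type*} {d : ℕ} (φ : S → A → EuclideanSpace ℝ (Fin d))
    (θ : EuclideanSpace ℝ (Fin d)) (s : S) (a : Fin 2 → A) :
    btlProb φ θ s a 0 = (1 - bias (inner ℝ (φ s (a 1) - φ s (a 0)) θ)) / 2 ∧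
      btlProb φ θ s a 1 = (1 + bias (inner ℝ (φ s (a 1) - φ s (a 0)) θ)) / 2 := by
  have hp : ∀ x y : ℝ, Real.exp y / (Real.exp x + Real.exp y) = Real.sigmoid (y - x) := by
    intro x y
    rw [Real.sigmoid_def, neg_sub, Real.exp_sub]
    field_simp
    rw [add_comm]
  have h1 : btlProb φ θ s a 1 = (1 + bias (inner ℝ (φ s (a 1) - φ s (a 0)) θ)) / 2 := by
    rw [btlProb, hp, inner_sub_left, bias, reward, reward]
    ring
  refine ⟨?_, h1⟩
  have hs : btlProb φ θ s a 0 + btlProb φ θ s a 1 = 1 := by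
    unfold btlProb
    rw [← add_div]
    exact div_self (by positivity)
  linarith

theorem labelLaw_bind_eq {S A Z : Type*} [MeasurableSpace Z] {d : ℕ}
    (φ : S → A → EuclideanSpace ℝ (Fin d)) (θ : EuclideanSpace ℝ (Fin d)) (s : S) (a : Fin 2 → A)
    (R : Kernel (Fin 2) Z) {ν : Measure Z} {h : Z → ℝ} (hm : Measurable h) (hb : ∀ z, |h z| ≤ 1)
    (h0 : R 0 = ν.withDensity (fun z => ENNReal.ofReal ((1 - h z) / 2)))
    (h1 : R 1 = ν.withDensity (fun z => ENNReal.ofReal ((1 + h z) / 2))) :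
    (labelLaw φ θ s a).bind R = ν.withDensity fun z =>
      ENNReal.ofReal ((1 + bias (inner ℝ (φ s (a 1) - φ s (a 0)) θ) * h z) / 2) := by
  have hp0 : 0 ≤ btlProb φ θ s a 0 := by unfold btlProb; positivity
  have hp1 : 0 ≤ btlProb φ θ s a 1 := by unfold btlProb; positivity
  obtain ⟨e0, e1⟩ := btlProb_eq φ θ s a
  have hbind : (labelLaw φ θ s a).bind R =
      ENNReal.ofReal (btlProb φ θ s a 0) • R 0 + ENNReal.ofReal (btlProb φ θ s a 1) • R 1 := by
    ext E hE
    rw [Measure.bind_apply hE R.measurable.aemeasurable]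
    simp [labelLaw, Fin.sum_univ_two, lintegral_add_measure, lintegral_smul_measure]
  have m0 : Measurable fun z => ENNReal.ofReal ((1 - h z) / 2) := by fun_prop
  have m1 : Measurable fun z => ENNReal.ofReal ((1 + h z) / 2) := by fun_prop
  rw [hbind, h0, h1, ← withDensity_smul _ m0, ← withDensity_smul _ m1,
    ← withDensity_add_left (m0.const_smul _)]
  congr 1
  ext z
  have hz := abs_le.1 (hb z)
  simp only [Pi.add_apply, Pi.smul_apply, smul_eq_mul]
  rw [← ENNReal.ofReal_mul hp0, ← ENNReal.ofReal_mul hp1, ← ENNReal.ofReal_add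
    (mul_nonneg hp0 (by linarith)) (mul_nonneg hp1 (by linarith)), e0, e1]
  congr 1
  ring

/-! ### Assouad's lemma. -/

/-- The sign `±1` of a bit. -/
def bitSign (b : Bool) : ℝ := if b then 1 else -1

/-- Flip the `j`-th bit of `v`. -/
def flipBit {k : ℕ} (j : Fin k) (v : Fin k → Bool) : Fin k → Bool := Function.update v j (!v j)

theorem flipBit_involutive {k : ℕ} (j : Fin k) : Function.Involutive (flipBit j) := by
  intro v
  simp [flipBit]

/-- **Assouad's lemma** for the squared Euclidean loss. -/
theorem exists_risk_ge {Ω : Type*} [MeasurableSpace Ω] (m : Measure Ω) {d k : ℕ}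
    (F : (Fin k → Bool) → Ω → ℝ) (hFm : ∀ v, Measurable (F v)) (hF0 : ∀ v z, 0 ≤ F v z)
    (hFi : ∀ v, Integrable (F v) m)
    (est : Kernel Ω (EuclideanSpace ℝ (Fin d))) [IsMarkovKernel est]
    (θ : (Fin k → Bool) → EuclideanSpace ℝ (Fin d)) (e : Fin k → Fin d)
    (he : Function.Injective e) (δ : ℝ) (hθ : ∀ v j, θ v (e j) = δ * bitSign (v j)) (K : ℝ)
    (hK : ∀ v, K ≤ ∑ j, ∫ z, min (F v z) (F (flipBit j v) z) ∂m) :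
    ∃ v, ENNReal.ofReal (δ ^ 2 * K) ≤
      ∫⁻ z, ∫⁻ t, ‖t - θ v‖ₑ ^ 2 ∂(est z) ∂(m.withDensity fun z => ENNReal.ofReal (F v z)) := by
  -- Conditional loss in coordinate `e j` given the data, if bit `j` were `b`.
  set G : Fin k → Bool → Ω → ℝ≥0∞ := fun j b z =>
    ∫⁻ t, ENNReal.ofReal ((t (e j) - δ * bitSign b) ^ 2) ∂(est z) with hG
  have hgm : ∀ j b, Measurable fun t : EuclideanSpace ℝ (Fin d) =>
      ENNReal.ofReal ((t (e j) - δ * bitSign b) ^ 2) := by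
    intro j b; fun_prop
  have hGm : ∀ j b, Measurable (G j b) := fun j b => (hgm j b).lintegral_kernel
  set A : (Fin k → Bool) → Fin k → ℝ≥0∞ := fun v j =>
    ∫⁻ z, ENNReal.ofReal (F v z) * G j (v j) z ∂m with hA
  have hAm : ∀ v j b, Measurable fun z => ENNReal.ofReal (F v z) * G j b z := fun v j b =>
    (hFm v).ennreal_ofReal.mul (hGm j b)
  have hrisk : ∀ v, ∑ j, A v j ≤
      ∫⁻ z, ∫⁻ t, ‖t - θ v‖ₑ ^ 2 ∂(est z) ∂(m.withDensity fun z => ENNReal.ofReal (F v z)) := by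
    intro v
    have hmm : Measurable fun z => ∫⁻ t, ‖t - θ v‖ₑ ^ 2 ∂(est z) := by
      refine Measurable.lintegral_kernel ?_
      fun_prop
    rw [lintegral_withDensity_eq_lintegral_mul _ (hFm v).ennreal_ofReal hmm,
      ← lintegral_finsetSum _ fun j _ => hAm v j (v j)]
    refine lintegral_mono fun z => ?_
    simp only [Pi.mul_apply]
    rw [← Finset.mul_sum]
    gcongr
    rw [hG]
    simp only
    rw [← lintegral_finsetSum _ fun j _ => hgm j (v j)]
    refine lintegral_mono fun t => ?_
    rw [← ENNReal.ofReal_sum_of_nonneg fun j _ => sq_nonneg _, ← ofReal_norm,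
      ← ENNReal.ofReal_pow (norm_nonneg _), EuclideanSpace.real_norm_sq_eq]
    refine ENNReal.ofReal_le_ofReal ?_
    calc ∑ j, (t (e j) - δ * bitSign (v j)) ^ 2 = ∑ j, ((t - θ v) (e j)) ^ 2 := by
          simp [hθ]
      _ = ∑ i ∈ Finset.univ.map ⟨e, he⟩, ((t - θ v) i) ^ 2 := by
          rw [Finset.sum_map]; rfl
      _ ≤ ∑ i, ((t - θ v) i) ^ 2 :=
          Finset.sum_le_sum_of_subset_of_nonneg (Finset.subset_univ _) fun i _ _ => sq_nonneg _
  have hpair : ∀ v j, ENNReal.ofReal (2 * δ ^ 2 * ∫ z, min (F v z) (F (flipBit j v) z) ∂m) ≤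
      A v j + A (flipBit j v) j := by
    intro v j
    have hmin0 : ∀ z, 0 ≤ min (F v z) (F (flipBit j v) z) := fun z => le_min (hF0 _ z) (hF0 _ z)
    have hmini : Integrable (fun z => min (F v z) (F (flipBit j v) z)) m := (hFi v).inf (hFi _)
    rw [← integral_const_mul, ofReal_integral_eq_lintegral_ofReal (hmini.const_mul _)
      (ae_of_all _ fun z => mul_nonneg (by positivity) (hmin0 z)), hA]
    simp only
    rw [← lintegral_add_left (hAm _ _ _)]
    refine lintegral_mono fun z => ?_
    have hflip : flipBit j v j = !v j := by simp [flipBit]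
    -- No guess is close to both `δ` and `-δ`: `(x - δ)² + (x + δ)² ≥ 2 δ²`.
    have hGG : ENNReal.ofReal (2 * δ ^ 2) ≤ G j (v j) z + G j (!v j) z := by
      rw [hG]
      simp only
      rw [← lintegral_add_left (hgm _ _)]
      calc ENNReal.ofReal (2 * δ ^ 2) = ∫⁻ _, ENNReal.ofReal (2 * δ ^ 2) ∂(est z) := by simp
        _ ≤ _ := lintegral_mono fun t => by
          rw [← ENNReal.ofReal_add (sq_nonneg _) (sq_nonneg _)]
          refine ENNReal.ofReal_le_ofReal ?_
          cases v j <;> simp only [bitSign, Bool.not_true, Bool.not_false, if_true, if_false,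
            Bool.false_eq_true] <;> nlinarith [sq_nonneg (t (e j))]
    calc ENNReal.ofReal (2 * δ ^ 2 * min (F v z) (F (flipBit j v) z))
        = ENNReal.ofReal (min (F v z) (F (flipBit j v) z)) * ENNReal.ofReal (2 * δ ^ 2) := by
          rw [mul_comm, ENNReal.ofReal_mul (hmin0 z)]
      _ ≤ ENNReal.ofReal (min (F v z) (F (flipBit j v) z)) * (G j (v j) z + G j (!v j) z) := by
          gcongr
      _ ≤ _ := by
          rw [mul_add, hflip]
          gcongr
          · exact min_le_left _ _
          · exact min_le_right _ _
  -- Averaging over vertices: flipping bit `j` permutes the cube, so summing the pair bounds counts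
  -- each loss twice.
  by_contra! hcon
  have hlt : ∑ v, ∑ j, A v j < ∑ _v : Fin k → Bool, ENNReal.ofReal (δ ^ 2 * K) :=
    ENNReal.sum_lt_sum_of_nonempty Finset.univ_nonempty fun v _ => (hrisk v).trans_lt (hcon v)
  have hge : 2 * ∑ _v : Fin k → Bool, ENNReal.ofReal (δ ^ 2 * K) ≤ 2 * ∑ v, ∑ j, A v j := by
    calc 2 * ∑ _v : Fin k → Bool, ENNReal.ofReal (δ ^ 2 * K)
        ≤ ∑ v : Fin k → Bool, ∑ j, (A v j + A (flipBit j v) j) := by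
          rw [Finset.mul_sum]
          refine Finset.sum_le_sum fun v _ => ?_
          refine le_trans ?_ (Finset.sum_le_sum fun j _ => hpair v j)
          rw [← ENNReal.ofReal_sum_of_nonneg fun j _ => mul_nonneg (by positivity)
            (integral_nonneg fun z => le_min (hF0 _ z) (hF0 _ z)), ← Finset.mul_sum,
            show (2 : ℝ≥0∞) = ENNReal.ofReal 2 by simp, ← ENNReal.ofReal_mul zero_le_two,
            ← mul_assoc]
          exact ENNReal.ofReal_le_ofReal (mul_le_mul_of_nonneg_left (hK v) (by positivity))
      _ = 2 * ∑ v, ∑ j, A v j := by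
          simp only [Finset.sum_add_distrib]
          rw [two_mul]
          congr 1
          rw [Finset.sum_comm, Finset.sum_comm (f := fun v j => A v j)]
          refine Finset.sum_congr rfl fun j _ => ?_
          exact Equiv.sum_comp (flipBit_involutive j).toPerm fun v => A v j
  exact absurd hlt (not_lt.2 ((ENNReal.mul_le_mul_iff_right two_ne_zero ENNReal.ofNat_ne_top).1 hge))

end LabelDP

/-! ### The hypercube in the sum-zero hyperplane. -/

namespace LabelDP

/-- The direction `e_j - e_{k+j}`. -/
noncomputable def pairVec {d k : ℕ} (hk : k + k ≤ d) (j : Fin k) : EuclideanSpace ℝ (Fin d) :=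
  EuclideanSpace.single (Fin.castLE hk (Fin.castAdd k j)) 1 -
    EuclideanSpace.single (Fin.castLE hk (Fin.natAdd k j)) 1

/-- The hypercube vertex `δ ∑ ± (e_j - e_{k+j})`. -/
noncomputable def vertex {d k : ℕ} (hk : k + k ≤ d) (δ : ℝ) (v : Fin k → Bool) :
    EuclideanSpace ℝ (Fin d) :=
  ∑ j, (δ * bitSign (v j)) • pairVec hk j

theorem abs_bitSign (b : Bool) : |bitSign b| = 1 := by cases b <;> simp [bitSign]

section
variable {d k : ℕ} (hk : k + k ≤ d)

theorem inner_pairVec (x : EuclideanSpace ℝ (Fin d)) (j : Fin k) :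
    inner ℝ x (pairVec hk j) =
      x (Fin.castLE hk (Fin.castAdd k j)) - x (Fin.castLE hk (Fin.natAdd k j)) := by
  simp [pairVec, inner_sub_right, EuclideanSpace.inner_single_right]

/-- The vectors have disjoint supports and squared norm `2`, so this is Bessel's inequality. -/
theorem sum_inner_pairVec_sq_le (x : EuclideanSpace ℝ (Fin d)) :
    ∑ j, inner ℝ x (pairVec hk j) ^ 2 ≤ 2 * ‖x‖ ^ 2 := by
  calc ∑ j, inner ℝ x (pairVec hk j) ^ 2
      ≤ ∑ j, 2 * (x (Fin.castLE hk (Fin.castAdd k j)) ^ 2 +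
          x (Fin.castLE hk (Fin.natAdd k j)) ^ 2) := by
        refine Finset.sum_le_sum fun j _ => ?_
        rw [inner_pairVec]
        nlinarith [sq_nonneg (x (Fin.castLE hk (Fin.castAdd k j)) +
          x (Fin.castLE hk (Fin.natAdd k j)))]
    _ = 2 * ∑ i : Fin (k + k), x (Fin.castLE hk i) ^ 2 := by
        rw [← Finset.mul_sum, Finset.sum_add_distrib, Fin.sum_univ_add]
    _ = 2 * ∑ i ∈ Finset.univ.map (Fin.castLEEmb hk), x i ^ 2 := by
        rw [Finset.sum_map]; rfl
    _ ≤ 2 * ∑ i, x i ^ 2 := by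
        gcongr
        exact Finset.subset_univ _
    _ = 2 * ‖x‖ ^ 2 := by rw [EuclideanSpace.real_norm_sq_eq]

/-- The triangle inequality is crude here, but only affects the threshold `N`, which may depend on
`d`. -/
theorem norm_vertex_le {δ : ℝ} (hδ : 0 ≤ δ) (v : Fin k → Bool) :
    ‖vertex hk δ v‖ ≤ 2 * k * δ := by
  calc ‖vertex hk δ v‖ ≤ ∑ j : Fin k, ‖(δ * bitSign (v j)) • pairVec hk j‖ := norm_sum_le _ _
    _ ≤ ∑ _j : Fin k, 2 * δ := by
        refine Finset.sum_le_sum fun j _ => ?_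
        rw [norm_smul, Real.norm_eq_abs, abs_mul, abs_bitSign, abs_of_nonneg hδ]
        have : ‖pairVec hk j‖ ≤ 2 := (norm_sub_le _ _).trans (by simp; norm_num)
        nlinarith
    _ = 2 * k * δ := by simp; ring

theorem sum_vertex (δ : ℝ) (v : Fin k → Bool) : ∑ i, vertex hk δ v i = 0 := by
  simp only [vertex, WithLp.ofLp_sum, Finset.sum_apply]
  rw [Finset.sum_comm]
  refine Finset.sum_eq_zero fun j _ => ?_
  simp [pairVec, ← Finset.mul_sum, Finset.sum_sub_distrib]

theorem vertex_apply (δ : ℝ) (v : Fin k → Bool) (j : Fin k) :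
    vertex hk δ v (Fin.castLE hk (Fin.castAdd k j)) = δ * bitSign (v j) := by
  simp only [vertex, WithLp.ofLp_sum, Finset.sum_apply]
  rw [Finset.sum_eq_single j]
  · have : k ≠ 0 := by have := j.2; omega
    simp [pairVec, Fin.ext_iff, this]
  · intro i _ hij
    have h1 : j.val ≠ i.val := fun h => hij (Fin.ext h.symm)
    have h2 : j.val ≠ i.val + k := by have := j.2; omega
    simp [pairVec, Fin.ext_iff, h1, h2]
  · simp

theorem vertex_sub_flipBit (δ : ℝ) (v : Fin k → Bool) (j : Fin k) :
    vertex hk δ v - vertex hk δ (flipBit j v) = (2 * δ * bitSign (v j)) • pairVec hk j := by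
  rw [vertex, vertex, ← Finset.sum_sub_distrib, Finset.sum_eq_single j]
  · rw [← sub_smul]
    congr 1
    cases h : v j <;> simp [flipBit, bitSign, h] <;> ring
  · intro i _ hij
    simp [flipBit, hij]
  · simp

end

/-! ### The lower bound at a fixed scale. -/

theorem integral_eq_one_of_withDensity {Z : Type*} [MeasurableSpace Z] {ν P : Measure Z}
    [IsProbabilityMeasure P] {F : Z → ℝ} (hm : Measurable F) (h0 : ∀ z, 0 ≤ F z)
    (hP : P = ν.withDensity fun z => ENNReal.ofReal (F z)) : ∫ z, F z ∂ν = 1 := by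
  rw [integral_eq_lintegral_of_nonneg_ae (ae_of_all _ h0) hm.aestronglyMeasurable,
    ← setLIntegral_univ, ← withDensity_apply _ MeasurableSet.univ, ← hP, measure_univ,
    ENNReal.toReal_one]

/-- The minimax lower bound at hypercube scale `δ`. -/
theorem exists_l2Risk_ge {S A : Type*} {d k n : ℕ} (hk : k + k ≤ d) {L B ε δ : ℝ}
    (hL : 0 < L) (hε : 0 < ε) (hδ : 0 ≤ δ) (hδL : 2 * L * (2 * k * δ) ≤ 1 / 2)
    (hδB : 2 * k * δ ≤ B)
    (hδn : 8 * δ ^ 2 * ((Real.exp ε - 1) / (Real.exp ε + 1)) ^ 2 * n * L ^ 2 ≤ k / 4)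
    (φ : S → A → EuclideanSpace ℝ (Fin d)) (hφ : ∀ s a, ‖φ s a‖ ≤ L)
    (s : Fin n → S) (a : Fin n → Fin 2 → A) (Z : Fin n → Type*) [∀ i, MeasurableSpace (Z i)]
    (R : ∀ i, Kernel (Fin 2) (Z i)) [∀ i, IsMarkovKernel (R i)]
    (hR : ∀ i, IsLabelDPRandomizer ε 0 (R i))
    (est : Kernel (∀ i, Z i) (EuclideanSpace ℝ (Fin d))) [IsMarkovKernel est] :
    ∃ θ ∈ paramSet d B, ENNReal.ofReal (δ ^ 2 * (k / 3)) ≤ l2Risk φ θ s a R est := by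
  have hE : 1 < Real.exp ε := Real.one_lt_exp_iff.2 hε
  set τ := (Real.exp ε - 1) / (Real.exp ε + 1) with hτ
  have hτ0 : 0 ≤ τ := div_nonneg (by linarith) (by linarith)
  have hτ1 : τ ≤ 1 := (div_le_one (by linarith)).2 (by linarith)
  choose h hm hb h0 h1 using fun i => (hR i).exists_density hε
  have hb1 : ∀ i z, |h i z| ≤ 1 := fun i z => (hb i z).trans hτ1
  set ν : ∀ i, Measure (Z i) := fun i => R i 0 + R i 1 with hν
  have hνfin : ∀ i, IsFiniteMeasure (ν i) := fun i => by rw [hν]; infer_instance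
  have hν2 : ∀ i, (ν i).real Set.univ = 2 := fun i => by
    rw [hν]
    simp only
    rw [measureReal_add_apply, probReal_univ, probReal_univ]
    norm_num
  set x : Fin n → EuclideanSpace ℝ (Fin d) := fun i => φ (s i) (a i 1) - φ (s i) (a i 0) with hx
  have hxL : ∀ i, ‖x i‖ ≤ 2 * L := fun i =>
    (norm_sub_le _ _).trans (by linarith [hφ (s i) (a i 1), hφ (s i) (a i 0)])
  set t : (Fin k → Bool) → Fin n → ℝ := fun v i => bias (inner ℝ (x i) (vertex hk δ v)) with ht
  have ht1 : ∀ v i, |t v i| ≤ 1 / 2 := fun v i => by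
    refine (abs_bias_le _).trans ((abs_real_inner_le_norm _ _).trans ?_)
    refine le_trans ?_ hδL
    exact mul_le_mul (hxL i) (norm_vertex_le hk hδ v) (norm_nonneg _) (by linarith)
  set F : (Fin k → Bool) → ∀ i, Z i → ℝ := fun v i z => (1 + t v i * h i z) / 2 with hF
  have hFm : ∀ v i, Measurable (F v i) := fun v i =>
    (((hm i).const_mul _).const_add 1).div_const 2
  have hth : ∀ v i z, |t v i * h i z| ≤ 1 := fun v i z => by
    rw [abs_mul]
    exact mul_le_one₀ ((ht1 v i).trans (by norm_num)) (abs_nonneg _) (hb1 i z)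
  have hF0 : ∀ v i z, 0 ≤ F v i z := fun v i z => by
    have := abs_le.1 (hth v i z)
    simp only [hF]; linarith
  have hF1 : ∀ v i z, F v i z ≤ 1 := fun v i z => by
    have := abs_le.1 (hth v i z)
    simp only [hF]; linarith
  have hlaw : ∀ v i, (labelLaw φ (vertex hk δ v) (s i) (a i)).bind (R i) =
      (ν i).withDensity fun z => ENNReal.ofReal (F v i z) := fun v i =>
    labelLaw_bind_eq φ _ _ _ (R i) (hm i) (hb1 i) (h0 i) (h1 i)
  have hFint : ∀ v i, ∫ z, F v i z ∂ν i = 1 := fun v i => by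
    have : IsProbabilityMeasure ((labelLaw φ (vertex hk δ v) (s i) (a i)).bind (R i)) :=
      inferInstance
    exact integral_eq_one_of_withDensity (hFm v i) (hF0 v i) (hlaw v i)
  -- `R i 1` and `ν i / 2` both have mass one, which forces `h i` to have mean zero.
  have hhint : ∀ i, ∫ z, h i z ∂ν i = 0 := fun i => by
    have e1 := integral_eq_one_of_withDensity (((hm i).const_add 1).div_const 2)
      (fun z => by have := abs_le.1 (hb1 i z); linarith) (h1 i)
    have hih : Integrable (h i) (ν i) :=
      Integrable.of_bound (hm i).aestronglyMeasurable 1 (ae_of_all _ (hb1 i))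
    rw [integral_div, integral_add (integrable_const _) hih, integral_const, hν2] at e1
    simp only [smul_eq_mul] at e1
    linarith
  set P : (Fin k → Bool) → (∀ i, Z i) → ℝ := fun v z => ∏ i, F v i (z i) with hP
  have hPm : ∀ v, Measurable (P v) := fun v =>
    Finset.measurable_prod _ fun i _ => (hFm v i).comp (measurable_pi_apply i)
  have hP0 : ∀ v z, 0 ≤ P v z := fun v z => Finset.prod_nonneg fun i _ => hF0 v i _
  have hP1 : ∀ v z, P v z ≤ 1 := fun v z =>
    Finset.prod_le_one (fun i _ => hF0 v i _) fun i _ => hF1 v i _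
  have hPi : ∀ v, Integrable (P v) (Measure.pi ν) := fun v =>
    Integrable.of_bound (hPm v).aestronglyMeasurable 1
      (ae_of_all _ fun z => by rw [Real.norm_of_nonneg (hP0 v z)]; exact hP1 v z)
  have hpriv : ∀ v, privateLaw φ (vertex hk δ v) s a R =
      (Measure.pi ν).withDensity fun z => ENNReal.ofReal (P v z) := fun v => by
    rw [privateLaw, ← pi_withDensity_ofReal ν (F v) (hFm v) (hF0 v) (hF1 v)]
    congr 1
    funext i
    exact hlaw v i
  -- The affinity losses total at most `k / 4` over all flips, leaving `4 / 3 * (k / 2 - k / 4) = k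
  -- / 3`.
  have hoverlap : ∀ v, (k : ℝ) / 3 ≤
      ∑ j, ∫ z, min (P v z) (P (flipBit j v) z) ∂Measure.pi ν := by
    intro v
    have hstep : ∀ j, 4 / 3 * (1 / 2 - ∑ i, (t v i - t (flipBit j v) i) ^ 2 * τ ^ 2 / 4) ≤
        ∫ z, min (P v z) (P (flipBit j v) z) ∂Measure.pi ν := by
      intro j
      refine integral_min_prod_ge ν (F v) (F (flipBit j v)) (hFm _) (hFm _) (hF0 _) (hF0 _)
        (hF1 _) (hF1 _) (hFint _) (hFint _) _ (fun i => by positivity) (fun i => ?_) fun i =>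
        one_sub_le_affinity (hν2 i) (hm i) hτ1 (hb i) (hhint i) (ht1 _ i) (ht1 _ i)
      have b1 := abs_le.1 (ht1 v i)
      have b2 := abs_le.1 (ht1 (flipBit j v) i)
      have q1 : (t v i - t (flipBit j v) i) ^ 2 ≤ 1 := by nlinarith
      have q2 : τ ^ 2 ≤ 1 := by nlinarith
      nlinarith [mul_le_one₀ q1 (sq_nonneg τ) q2]
    refine le_trans ?_ (Finset.sum_le_sum fun j _ => hstep j)
    have hdiff : ∀ i, ∑ j, (t v i - t (flipBit j v) i) ^ 2 ≤ 32 * δ ^ 2 * L ^ 2 := by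
      intro i
      calc ∑ j, (t v i - t (flipBit j v) i) ^ 2
          ≤ ∑ j, 4 * δ ^ 2 * inner ℝ (x i) (pairVec hk j) ^ 2 := by
            refine Finset.sum_le_sum fun j _ => ?_
            have := abs_bias_sub_le (inner ℝ (x i) (vertex hk δ v))
              (inner ℝ (x i) (vertex hk δ (flipBit j v)))
            refine (sq_le_sq.2 this).trans (le_of_eq ?_)
            have hs : bitSign (v j) ^ 2 = 1 := by rw [← sq_abs, abs_bitSign, one_pow]
            rw [← inner_sub_right, vertex_sub_flipBit, inner_smul_right, mul_pow, mul_pow, hs]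
            ring
        _ = 4 * δ ^ 2 * ∑ j, inner ℝ (x i) (pairVec hk j) ^ 2 := by rw [Finset.mul_sum]
        _ ≤ 4 * δ ^ 2 * (2 * (2 * L) ^ 2) := by
            have := sum_inner_pairVec_sq_le hk (x i)
            have h2 : ‖x i‖ ^ 2 ≤ (2 * L) ^ 2 := pow_le_pow_left₀ (norm_nonneg _) (hxL i) 2
            gcongr
            linarith
        _ = 32 * δ ^ 2 * L ^ 2 := by ring
    have htot : ∑ j, ∑ i, (t v i - t (flipBit j v) i) ^ 2 * τ ^ 2 / 4 ≤ (k : ℝ) / 4 := by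
      rw [Finset.sum_comm]
      calc ∑ i, ∑ j, (t v i - t (flipBit j v) i) ^ 2 * τ ^ 2 / 4
          ≤ ∑ _i : Fin n, 32 * δ ^ 2 * L ^ 2 * τ ^ 2 / 4 := by
            refine Finset.sum_le_sum fun i _ => ?_
            rw [← Finset.sum_div, ← Finset.sum_mul]
            have := hdiff i
            gcongr
        _ = 8 * δ ^ 2 * τ ^ 2 * n * L ^ 2 := by simp; ring
        _ ≤ k / 4 := hδn
    rw [← Finset.mul_sum, Finset.sum_sub_distrib]
    simp only [Finset.sum_const, Finset.card_univ, Fintype.card_fin, nsmul_eq_mul]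
    linarith
  obtain ⟨v, hv⟩ := exists_risk_ge (Measure.pi ν) P hPm hP0 hPi est (vertex hk δ)
    (fun j => Fin.castLE hk (Fin.castAdd k j))
    ((Fin.castLE_injective hk).comp (Fin.castAdd_injective k k)) δ (vertex_apply hk δ) (k / 3)
    hoverlap
  refine ⟨vertex hk δ v, ⟨sum_vertex hk δ v, (norm_vertex_le hk hδ v).trans hδB⟩, ?_⟩
  rw [l2Risk, hpriv v]
  exact hv

end LabelDP

/-! ### Choice of the scale. -/

theorem mainTheorem3 :
    ∃ c : ℝ, 0 < c ∧
      ∀ (d : ℕ) (L B ε : ℝ), 2 ≤ d → 0 < L → 0 < B → 0 < ε →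
        ∃ N : ℕ, ∀ n : ℕ, N ≤ n →
          ∀ (S A : Type*) (φ : S → A → EuclideanSpace ℝ (Fin d)),
            (∀ s a, ‖φ s a‖ ≤ L) →
          ∀ (s : Fin n → S) (a : Fin n → Fin 2 → A)
            (Z : Fin n → Type*) [∀ i, MeasurableSpace (Z i)]
            (R : ∀ i, Kernel (Fin 2) (Z i)) [∀ i, IsMarkovKernel (R i)],
            (∀ i, LabelDP.IsLabelDPRandomizer ε 0 (R i)) →
          ∀ (est : Kernel (∀ i, Z i) (EuclideanSpace ℝ (Fin d))) [IsMarkovKernel est],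
            ∃ θ ∈ LabelDP.paramSet d B,
              ENNReal.ofReal
                  (c * ((d : ℝ) / L ^ 2 *
                    ((d : ℝ) / n + (d : ℝ) / ((Real.exp ε - 1) ^ 2 * n)))) ≤
                LabelDP.l2Risk φ θ s a R est := by
  -- The risk bound is `δ² k / 3 = k² / (96 τ² L² n)`, and `k ≥ d / 3` gives `864 = 96 * 9`.
  refine ⟨1 / 864, by norm_num, fun d L B ε hd hL hB hε => ?_⟩
  have hE : 0 < Real.exp ε - 1 := sub_pos.2 (Real.one_lt_exp_iff.2 hε)
  set τ := (Real.exp ε - 1) / (Real.exp ε + 1) with hτ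
  have hτ0 : 0 < τ := div_pos hE (by positivity)
  obtain ⟨k, hk, hk3, hk0⟩ : ∃ k : ℕ, k + k ≤ d ∧ d ≤ 3 * k ∧ 0 < k :=
    ⟨d / 2, by omega, by omega, by omega⟩
  have hkR : (0 : ℝ) < k := Nat.cast_pos.2 hk0
  have hdk : (d : ℝ) ≤ 3 * k := by exact_mod_cast hk3
  -- The largest scale that keeps the vertices in the ball and the log-odds below `1 / 2`, by the
  -- crude norm bound.
  set M : ℝ := min B (1 / (4 * L)) / (2 * k) with hM
  have hM0 : 0 < M := div_pos (lt_min hB (by positivity)) (by positivity)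
  -- Taking `δ² = q / n` turns the information budget `8 δ² τ² n L² ≤ k / 4` into an equality.
  set q : ℝ := k / (32 * τ ^ 2 * L ^ 2) with hq
  have hq0 : 0 < q := by positivity
  obtain ⟨N, hN⟩ := exists_nat_ge (q / M ^ 2)
  -- The extra one ensures `n > 0`.
  refine ⟨N + 1, fun n hn S A φ hφ s a Z _ R _ hR est _ => ?_⟩
  have hnN : (N : ℝ) ≤ n := by exact_mod_cast (Nat.le_succ N).trans hn
  have hn0 : (0 : ℝ) < n := by exact_mod_cast (Nat.succ_pos N).trans_le hn
  have hδ2 : √(q / n) ^ 2 = q / n := Real.sq_sqrt (by positivity)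
  have hδM : √(q / n) ≤ M := by
    rw [Real.sqrt_le_left hM0.le, div_le_iff₀ hn0]
    have := hN.trans hnN
    rw [div_le_iff₀ (by positivity)] at this
    linarith
  have hδmin : 2 * k * √(q / n) ≤ min B (1 / (4 * L)) := by
    rw [hM, le_div_iff₀ (by positivity)] at hδM
    linarith
  have hδL : 2 * L * (2 * k * √(q / n)) ≤ 1 / 2 := by
    have h1 := hδmin.trans (min_le_right _ _)
    rw [le_div_iff₀ (by positivity)] at h1
    linarith
  obtain ⟨θ, hθ, hr⟩ := LabelDP.exists_l2Risk_ge hk hL hε (Real.sqrt_nonneg (q / n)) hδL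
    (hδmin.trans (min_le_left _ _))
    (by
      rw [hδ2, ← hτ, hq]
      refine le_of_eq ?_
      field_simp
      norm_num) φ hφ s a Z R hR est
  refine ⟨θ, hθ, le_trans (ENNReal.ofReal_le_ofReal ?_) hr⟩
  rw [hδ2]
  -- With `w = 1 / (e^ε - 1)`, `1 / τ² = (1 + 2 w)² ≥ 1 + w²`.
  have hτinv : 1 + 1 / (Real.exp ε - 1) ^ 2 ≤ 1 / τ ^ 2 := by
    have e : 1 / τ ^ 2 = (1 + 2 / (Real.exp ε - 1)) ^ 2 := by
      rw [hτ]
      field_simp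
      ring
    have hi : 0 < 1 / (Real.exp ε - 1) := by positivity
    rw [e, show 1 / (Real.exp ε - 1) ^ 2 = (1 / (Real.exp ε - 1)) ^ 2 by rw [one_div_pow],
      show 2 / (Real.exp ε - 1) = 2 * (1 / (Real.exp ε - 1)) by ring]
    nlinarith
  calc 1 / 864 * ((d : ℝ) / L ^ 2 * ((d : ℝ) / n + (d : ℝ) / ((Real.exp ε - 1) ^ 2 * n)))
      = 1 / 864 * (d : ℝ) ^ 2 * (1 / (L ^ 2 * n)) * (1 + 1 / (Real.exp ε - 1) ^ 2) := by
        field_simp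
    _ ≤ 1 / 864 * (3 * k) ^ 2 * (1 / (L ^ 2 * n)) * (1 / τ ^ 2) := by gcongr
    _ = q / n * (k / 3) := by
        rw [hq]
        field_simp
        norm_num
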